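/- Let $\alpha,\beta,\gamma\in[0,1]$. For $n\ge 0$ let $K(n,\mathbf P)$ be the random simple graph with vertex set $V=\{0,1\}^n$ in which, independently for each unordered pair of distinct vertices $u,v$, the vertices $u=(u_1,\dots,u_n)$ and $v=(v_1,\dots,v_n)$ are adjacent with probability $p_{u,v}=\prod_{i=1}^n\mathbf P[u_i,v_i]$, where $\mathbf P$ is the symmetric matrix with rows and columns labelled by $1,0$ and entries $\mathbf P[1,1]=\alpha$, $\mathbf P[1,0]=\mathbf P[0,1]=\beta$, $\mathbf P[0,0]=\gamma$. For $v\in V$ let $w(v)=\sum_{i=1}^n v_i$, and for even $n$ let $H_n$ be the subgraph of $K(n,\mathbf P)$ induced by the middle layer $\{v\in V: w(v)=n/2\}$. Suppose $\alpha=\gamma$ and $\beta+\gamma>1$. Then there is a constant $c$, depending only on $\alpha$ and $\beta$, such that $$\lim_{\substack{n\to\infty\\ n\text{ even}}}\mathbb P\bigl(\operatorname{diam}(H_n)<c\bigr)=1,$$ where the diameter of a disconnected graph is $\infty$. -/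

import Mathlib

open MeasureTheory ProbabilityTheory

/-- The vertex set `{0,1}ⁿ`. -/
abbrev KVertex (n : ℕ) : Type := Fin n → Fin 2

/-- The symmetric `2 × 2` matrix `P`, whose rows and columns are labelled by `0` and `1` in this
order: `P[1,1] = α`, `P[0,1] = P[1,0] = β`, `P[0,0] = γ`. All entries lie in `[0,1]`. -/
def kInitiator (α β γ : unitInterval) : Matrix (Fin 2) (Fin 2) unitInterval :=
  !![γ, β; β, α]

lemma kInitiator_symm (α β γ : unitInterval) (i j : Fin 2) :
    kInitiator α β γ i j = kInitiator α β γ j i := by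
  fin_cases i <;> fin_cases j <;> rfl

/-- The probability `p_{u,v} = ∏ᵢ P[uᵢ, vᵢ]` attached to the unordered pair `{u, v}`. -/
def kEdgeProb (α β γ : unitInterval) (n : ℕ) : Sym2 (KVertex n) → unitInterval :=
  Sym2.lift ⟨fun u v => ∏ i, kInitiator α β γ (u i) (v i), fun u v =>
    Finset.prod_congr rfl fun i _ => kInitiator_symm α β γ (u i) (v i)⟩

/-- The simple graph whose edges are the pairs (of distinct vertices) selected by `ω`. -/
def kGraphOf (n : ℕ) (ω : Sym2 (KVertex n) → Prop) : SimpleGraph (KVertex n) :=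
  SimpleGraph.fromEdgeSet {e | ω e}

/-- The law of the Kronecker random graph `K(n, P)`: the unordered pairs `{u, v}` are selected
independently, each with probability `p_{u,v}`, and the selected pairs of distinct vertices are
the edges. -/
noncomputable def kroneckerGraph (α β γ : unitInterval) (n : ℕ) :
    Measure (SimpleGraph (KVertex n)) :=
  (Measure.pi fun e : Sym2 (KVertex n) =>
    bernoulliMeasure True False (kEdgeProb α β γ n e)).map (kGraphOf n)

lemma measurable_kGraphOf (n : ℕ) : Measurable (kGraphOf n) :=
  SimpleGraph.measurable_fromEdgeSet.comp MeasurableEquiv.setOfPred.measurable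

instance (α β γ : unitInterval) (n : ℕ) : IsProbabilityMeasure (kroneckerGraph α β γ n) :=
  Measure.isProbabilityMeasure_map (measurable_kGraphOf n).aemeasurable

/-- The weight `w(v)`: the number of ones among the coordinates of `v`. -/
def kWeight {n : ℕ} (v : KVertex n) : ℕ := ∑ i, (v i : ℕ)

/-- The middle layer `{v : w(v) = n/2}`. -/
def kMiddleLayer (n : ℕ) : Set (KVertex n) := {v | 2 * kWeight v = n}

/-! Write a = α + β > 1. For a suitable even L, any two middle-layer vertices at Hamming distance at
most a small fraction of n are joined by a path of length at most L, except with probability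
exponentially small in n. Any two vertices of the layer are linked through it by boundedly many such
Hamming steps, so a union bound over all pairs bounds the diameter.

To find the path, each edge set is split into L independent sparser layers, and walks are counted
whose j-th step uses the j-th layer (`real_not_exists_walkProfile_le`). Given the layers already
revealed, each count for the next step is a sum of independent weighted Bernoulli variables, so
Chernoff bounds apply with the conditional expectation as mean (`real_not_walkProfile_succ_le`). The
argument closes if the expected number of u–v walks of length L far exceeds the expected
contribution of any single edge, which leaves only L - 1 free steps.

Up to polynomial factors, the first quantity is at least (τ a^L / 2)^n. Row sums of the middle layer
are about a^n (`pow_le_rowSum_pairProb`), Cauchy–Schwarz turns them into closed-walk counts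
(`pow_le_card_mul_matrix_pow_diag`), and moving one endpoint a short Hamming distance costs at most
τ^n (`pow_hammingDist_mul_matrix_pow_le`). The second is at most ((a^(L-1) + 1) / 2)^n, because the
weights are a tensor power of a 2 × 2 matrix with eigenvalues α + β and α - β (`matrix_pow_le_pow`).
With τ < 1 and τ a > 1, the first base exceeds the second for L large. -/

/-- The indicator of a proposition, as a real number. -/
noncomputable def propInd (a : Prop) : ℝ := open Classical in if a then 1 else 0

lemma propInd_true : propInd True = 1 := by simp [propInd]

lemma propInd_false : propInd False = 0 := by simp [propInd]

lemma propInd_nonneg (a : Prop) : 0 ≤ propInd a := by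
  unfold propInd; split_ifs <;> norm_num

lemma of_propInd_ne_zero {a : Prop} (h : propInd a ≠ 0) : a := by
  by_contra ha
  exact h (by simp [propInd, ha])

/-- The law of a random subset of `E` that contains each `e` independently with
probability `p e`. -/
noncomputable abbrev bernoulliPi {E : Type*} [Fintype E] (p : E → unitInterval) :
    Measure (E → Prop) :=
  Measure.pi fun e => bernoulliMeasure True False (p e)

/-! ### Chernoff bounds for weighted Bernoulli sums. -/

section Concentration

variable {E : Type*} [Fintype E]

lemma map_or_bernoulliMeasure (p q r : unitInterval)
    (h : 1 - (r : ℝ) = (1 - p) * (1 - q)) :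
    ((bernoulliMeasure True False p).prod (bernoulliMeasure True False q)).map
      (fun a : Prop × Prop => a.1 ∨ a.2) = bernoulliMeasure True False r := by
  have hm : Measurable fun a : Prop × Prop => a.1 ∨ a.2 := measurable_of_finite _
  have hF : ((bernoulliMeasure True False p).prod (bernoulliMeasure True False q)).map
      (fun a : Prop × Prop => a.1 ∨ a.2) {False} = (bernoulliMeasure True False r) {False} := by
    rw [Measure.map_apply hm (by measurability)]
    have : (fun a : Prop × Prop => a.1 ∨ a.2) ⁻¹' {False} = {False} ×ˢ {False} := by
      ext ⟨a, b⟩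
      simp
    rw [this, Measure.prod_prod]
    have key : ∀ s : unitInterval, (bernoulliMeasure True False s) {False} =
        ENNReal.ofReal (1 - s) := by
      intro s
      rw [← ofReal_measureReal, bernoulliMeasure_real_apply_of_notMem_of_mem _ (by measurability)
        (by simp) (by simp)]
    rw [key, key, key, h, ENNReal.ofReal_mul (by linarith [p.2.2])]
  have : IsProbabilityMeasure (((bernoulliMeasure True False p).prod
      (bernoulliMeasure True False q)).map (fun a : Prop × Prop => a.1 ∨ a.2)) :=
    Measure.isProbabilityMeasure_map hm.aemeasurable
  refine Measure.ext_of_singleton fun a => ?_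
  by_cases ha : a
  · have hc : ({a} : Set Prop) = {False}ᶜ := by
      ext b
      by_cases hb : b <;> simp [ha, hb]
    rw [hc, prob_compl_eq_one_sub (by measurability), prob_compl_eq_one_sub (by measurability), hF]
  · simpa [ha] using hF

/-- Superimposing independent random edge sets gives another one; this is what allows the edges to
be revealed layer by layer. -/
lemma map_or_bernoulliPi (p q r : E → unitInterval)
    (h : ∀ e, 1 - (r e : ℝ) = (1 - p e) * (1 - q e)) :
    ((bernoulliPi p).prod (bernoulliPi q)).map
      (fun ω : (E → Prop) × (E → Prop) => fun e => ω.1 e ∨ ω.2 e) = bernoulliPi r := by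
  have hm : Measurable fun a : Prop × Prop => a.1 ∨ a.2 := measurable_of_finite _
  have h1 := measurePreserving_arrowProdEquivProdArrow Prop Prop E
    (fun e => bernoulliMeasure True False (p e)) (fun e => bernoulliMeasure True False (q e))
  rw [bernoulliPi, bernoulliPi, ← h1.map_eq, Measure.map_map (measurable_of_finite _) h1.measurable]
  have h2 := Measure.pi_map_pi (μ := fun e => (bernoulliMeasure True False (p e)).prod
    (bernoulliMeasure True False (q e))) (f := fun _ (a : Prop × Prop) => a.1 ∨ a.2)
    (fun _ => hm.aemeasurable)
  simp only [map_or_bernoulliMeasure _ _ _ (h _)] at h2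
  exact h2

lemma integral_exp_sum_bernoulliPi (p : E → unitInterval) (c : E → ℝ) :
    ∫ ω, Real.exp (∑ e, c e * propInd (ω e)) ∂bernoulliPi p
      = ∏ e, (1 + p e * (Real.exp (c e) - 1)) := by
  simp_rw [Real.exp_sum]
  rw [integral_fintype_prod_eq_prod (μ := fun e => bernoulliMeasure True False (p e))
    (fun e a => Real.exp (c e * propInd a))]
  refine Finset.prod_congr rfl fun e _ => ?_
  rw [integral_bernoulliMeasure, propInd_true, propInd_false]
  simp only [mul_one, mul_zero, Real.exp_zero, smul_eq_mul]
  ring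

lemma integral_exp_sum_bernoulliPi_le (p : E → unitInterval) (c : E → ℝ) :
    ∫ ω, Real.exp (∑ e, c e * propInd (ω e)) ∂bernoulliPi p
      ≤ Real.exp (∑ e, p e * (Real.exp (c e) - 1)) := by
  rw [integral_exp_sum_bernoulliPi, Real.exp_sum]
  refine Finset.prod_le_prod (fun e _ => ?_) fun e _ => ?_
  · nlinarith [(p e).2.1, (p e).2.2, Real.exp_pos (c e)]
  · linarith [Real.add_one_le_exp ((p e : ℝ) * (Real.exp (c e) - 1))]

/-- Exponential Markov inequality for weighted Bernoulli sums. -/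
lemma bernoulliPi_real_le_exp (p : E → unitInterval) (c : E → ℝ) (t B : ℝ)
    (hB : ∑ e, p e * (Real.exp (c e) - 1) ≤ B) :
    (bernoulliPi p).real {ω | t ≤ ∑ e, c e * propInd (ω e)} ≤ Real.exp (B - t) := by
  have h := mul_meas_ge_le_integral_of_nonneg (μ := bernoulliPi p)
    (f := fun ω => Real.exp (∑ e, c e * propInd (ω e)))
    (Filter.Eventually.of_forall fun _ => (Real.exp_pos _).le) Integrable.of_finite (Real.exp t)
  simp only [Real.exp_le_exp] at h
  rw [Real.exp_sub, le_div_iff₀ (Real.exp_pos t), mul_comm]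
  exact h.trans ((integral_exp_sum_bernoulliPi_le p c).trans (Real.exp_le_exp.2 hB))

lemma exp_sub_one_le_two_mul {x : ℝ} (h0 : 0 ≤ x) (h1 : x ≤ 1) : Real.exp x - 1 ≤ 2 * x := by
  have := Real.abs_exp_sub_one_le (x := x) (by rwa [abs_of_nonneg h0])
  rw [abs_of_nonneg h0] at this
  exact (le_abs_self _).trans this

lemma exp_neg_sub_one_le {x : ℝ} (h0 : 0 ≤ x) (h1 : x ≤ 1) : Real.exp (-x) - 1 ≤ -(x / 2) := by
  have h := Real.one_sub_inv_le_log_of_pos (x := 1 - x / 2) (by linarith)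
  have h2 : -x ≤ 1 - (1 - x / 2)⁻¹ := by
    have h3 : (1 - x / 2)⁻¹ ≤ 1 + x := by
      rw [inv_le_comm₀ (by linarith) (by linarith), inv_eq_one_div, div_le_iff₀ (by linarith)]
      nlinarith
    linarith
  have := Real.exp_le_exp.2 (h2.trans h)
  rw [Real.exp_log (by linarith)] at this
  linarith

/-- Upper tail of a Bernoulli sum with weights in `[0, M]`. -/
lemma bernoulliPi_real_upper_tail (p : E → unitInterval) (c : E → ℝ) {M s : ℝ} (hM : 0 < M)
    (hc0 : ∀ e, 0 ≤ c e) (hcM : ∀ e, c e ≤ M) :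
    (bernoulliPi p).real {ω | 2 * ∑ e, c e * p e + M * s ≤ ∑ e, c e * propInd (ω e)}
      ≤ Real.exp (-s) := by
  have h := bernoulliPi_real_le_exp p (fun e => c e / M) (2 * (∑ e, c e * p e) / M + s)
    (2 * (∑ e, c e * p e) / M) (by
      rw [mul_div_assoc, Finset.sum_div, Finset.mul_sum]
      refine Finset.sum_le_sum fun e _ => ?_
      have := exp_sub_one_le_two_mul (div_nonneg (hc0 e) hM.le) ((div_le_one hM).2 (hcM e))
      calc (p e : ℝ) * (Real.exp (c e / M) - 1) ≤ p e * (2 * (c e / M)) :=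
            mul_le_mul_of_nonneg_left this (p e).2.1
        _ = _ := by ring)
  rw [sub_add_cancel_left] at h
  convert h using 3
  ext ω
  have e1 : ∑ e, c e / M * propInd (ω e) = (∑ e, c e * propInd (ω e)) / M := by
    rw [Finset.sum_div]
    exact Finset.sum_congr rfl fun e _ => by ring
  rw [e1, le_div_iff₀ hM, add_mul, div_mul_cancel₀ _ hM.ne',
    mul_comm M s]

/-- Lower tail of a Bernoulli sum with weights in `[0, M]`. -/
lemma bernoulliPi_real_lower_tail (p : E → unitInterval) (c : E → ℝ) {M s : ℝ} (hM : 0 < M)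
    (hc0 : ∀ e, 0 ≤ c e) (hcM : ∀ e, c e ≤ M) (hs : 4 * M * s ≤ ∑ e, c e * p e) :
    (bernoulliPi p).real {ω | ∑ e, c e * propInd (ω e) ≤ (∑ e, c e * p e) / 4}
      ≤ Real.exp (-s) := by
  -- Since e^(-x) - 1 ≤ -x/2 on [0, 1], the exponent is at most -mean/(2M); the threshold mean/4
  -- gives back mean/(4M), and the mean/(4M) that remains is at least s.
  have h := bernoulliPi_real_le_exp p (fun e => -(c e / M)) (-((∑ e, c e * p e) / 4 / M))
    (-((∑ e, c e * p e) / 2 / M)) (by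
      rw [Finset.sum_div, Finset.sum_div, ← Finset.sum_neg_distrib]
      refine Finset.sum_le_sum fun e _ => ?_
      have := exp_neg_sub_one_le (div_nonneg (hc0 e) hM.le) ((div_le_one hM).2 (hcM e))
      calc (p e : ℝ) * (Real.exp (-(c e / M)) - 1) ≤ p e * (-(c e / M / 2)) :=
            mul_le_mul_of_nonneg_left this (p e).2.1
        _ = _ := by ring)
  have h2 : Real.exp (-((∑ e, c e * p e) / 2 / M) - -((∑ e, c e * p e) / 4 / M))
      ≤ Real.exp (-s) := by
    rw [Real.exp_le_exp]
    have : s ≤ (∑ e, c e * p e) / (4 * M) := by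
      rw [le_div_iff₀ (by positivity)]
      linarith
    have e2 : (∑ e, c e * (p e : ℝ)) / 2 / M - (∑ e, c e * p e) / 4 / M
      = (∑ e, c e * p e) / (4 * M) := by
      field_simp; ring
    linarith
  refine le_trans (le_of_eq ?_) (h.trans h2)
  congr 1
  ext ω
  have e1 : ∑ e, -(c e / M) * propInd (ω e) = -((∑ e, c e * propInd (ω e)) / M) := by
    rw [Finset.sum_div, ← Finset.sum_neg_distrib]
    exact Finset.sum_congr rfl fun e _ => by ring
  rw [Set.mem_ofPred_eq, Set.mem_ofPred_eq, e1, neg_le_neg_iff, div_le_div_iff_of_pos_right hM]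

end Concentration

/-! ### Walk counts revealed one edge layer at a time. -/

section Growth

open Matrix

variable {E T : Type*}

/-- The matrix of edge probabilities, for an edge labelling `ed`. -/
def probMatrix (ed : T → T → E) (p : E → unitInterval) : Matrix T T ℝ :=
  Matrix.of fun x y => (p (ed x y) : ℝ)

/-- The zero-one matrix of the edges present in `ω`. -/
noncomputable def openMatrix (ed : T → T → E) (ω : E → Prop) : Matrix T T ℝ :=
  Matrix.of fun x y => propInd (ω (ed x y))

/-- The graph of the edges present in `ω`. -/
def openGraph (ed : T → T → E) (ω : E → Prop) : SimpleGraph T :=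
  SimpleGraph.fromRel fun x y => ω (ed x y)

lemma openGraph_mono (ed : T → T → E) {ω ω' : E → Prop} (h : ∀ e, ω e → ω' e) :
    openGraph ed ω ≤ openGraph ed ω' := by
  intro x y hxy
  rw [openGraph, SimpleGraph.fromRel_adj] at hxy ⊢
  exact ⟨hxy.1, hxy.2.imp (h _) (h _)⟩

variable [Fintype T]

/-- The total weight `∑ N x * h y` over the ordered pairs labelled by the edge `e`. -/
noncomputable def pairWeight (ed : T → T → E) (N h : T → ℝ) (e : E) : ℝ :=
  open Classical in ∑ z : T × T with ed z.1 z.2 = e, N z.1 * h z.2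

/-- The entries at (x, y) and (y, x) can share one Bernoulli variable. Grouping by edge makes the
form a sum over independent variables, at the price of a factor 2 in the weights. -/
lemma vecMul_dotProduct_eq_sum_pairWeight [Fintype E] (ed : T → T → E) (N h : T → ℝ) (f : E → ℝ) :
    (N ᵥ* Matrix.of (fun x y => f (ed x y))) ⬝ᵥ h = ∑ e, pairWeight ed N h e * f e := by
  classical
  have h1 : (N ᵥ* Matrix.of (fun x y => f (ed x y))) ⬝ᵥ h
      = ∑ z : T × T, N z.1 * h z.2 * f (ed z.1 z.2) := by
    simp only [dotProduct, vecMul, Matrix.of_apply, Finset.sum_mul]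
    rw [Fintype.sum_prod_type_right]
    exact Finset.sum_congr rfl fun _ _ => Finset.sum_congr rfl fun _ _ => by ring
  rw [h1, ← Finset.sum_fiberwise Finset.univ (fun z : T × T => ed z.1 z.2)]
  refine Finset.sum_congr rfl fun e _ => ?_
  rw [pairWeight, Finset.sum_mul]
  refine Finset.sum_congr (by congr) fun z hz => ?_
  rw [(Finset.mem_filter.1 hz).2]

/-- Each edge labels at most two ordered pairs. -/
def FiberLeTwo (ed : T → T → E) : Prop :=
  open Classical in ∀ e, (Finset.univ.filter fun z : T × T => ed z.1 z.2 = e).card ≤ 2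

lemma pairWeight_nonneg (ed : T → T → E) {N h : T → ℝ} (hN : ∀ x, 0 ≤ N x) (hh : ∀ x, 0 ≤ h x)
    (e : E) : 0 ≤ pairWeight ed N h e :=
  Finset.sum_nonneg fun _ _ => mul_nonneg (hN _) (hh _)

lemma pairWeight_le {ed : T → T → E} (hed : FiberLeTwo ed) {N h : T → ℝ} {C : ℝ} (hC : 0 ≤ C)
    (hNh : ∀ x y, N x * h y ≤ C) (e : E) : pairWeight ed N h e ≤ 2 * C := by
  classical
  refine (Finset.sum_le_card_nsmul _ _ C fun z _ => hNh _ _).trans ?_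
  rw [nsmul_eq_mul]
  exact mul_le_mul_of_nonneg_right (by exact_mod_cast hed e) hC

/-- `N` is a plausible vector of numbers of walks of length `j`: the expected numbers of its
extensions to walks of length `m ≤ L` are at most `K ^ j * g m`, and the expected number of those
of length `L` that end at `v` is at least `X / 4 ^ j`. -/
structure WalkProfile [DecidableEq T] (A : Matrix T T ℝ) (g : ℕ → ℝ) (K X : ℝ) (L : ℕ) (v : T)
    (j : ℕ) (N : T → ℝ) : Prop where
  nonneg : ∀ x, 0 ≤ N x
  upper : ∀ m, j ≤ m → m ≤ L → ∀ y, (N ᵥ* A ^ (m - j)) y ≤ K ^ j * g m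
  lower : X / 4 ^ j ≤ (N ᵥ* A ^ (L - j)) v

lemma vecMul_pow_succ_apply [DecidableEq T] (N : T → ℝ) (A : Matrix T T ℝ) (k : ℕ) (y : T) :
    (N ᵥ* A ^ (k + 1)) y = (N ᵥ* A) ⬝ᵥ fun z => (A ^ k) z y := by
  rw [pow_succ', ← vecMul_vecMul]
  rfl

lemma probMatrix_pow_nonneg [DecidableEq T] (ed : T → T → E) (p : E → unitInterval) (k : ℕ)
    (x y : T) : 0 ≤ (probMatrix ed p ^ k) x y := by
  induction k generalizing x y with
  | zero => rw [pow_zero, Matrix.one_apply]; split_ifs <;> norm_num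
  | succ k ih =>
    rw [pow_succ, Matrix.mul_apply]
    exact Finset.sum_nonneg fun z _ => mul_nonneg (ih _ _) (p _).2.1

lemma vecMul_openMatrix_nonneg (ed : T → T → E) (ω : E → Prop) {N : T → ℝ} (hN : ∀ x, 0 ≤ N x)
    (y : T) : 0 ≤ (N ᵥ* openMatrix ed ω) y :=
  Finset.sum_nonneg fun x _ => mul_nonneg (hN x) (propInd_nonneg _)

variable [Fintype E]

lemma real_openMatrix_upper_tail {ed : T → T → E} (hed : FiberLeTwo ed) (p : E → unitInterval)
    {N h : T → ℝ} (hN : ∀ x, 0 ≤ N x) (hh : ∀ x, 0 ≤ h x) {C s : ℝ} (hC : 0 < C)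
    (hNh : ∀ x y, N x * h y ≤ C) :
    (bernoulliPi p).real {ω | 2 * ((N ᵥ* probMatrix ed p) ⬝ᵥ h) + 2 * C * s
      ≤ (N ᵥ* openMatrix ed ω) ⬝ᵥ h} ≤ Real.exp (-s) := by
  have h1 := bernoulliPi_real_upper_tail p (pairWeight ed N h) (M := 2 * C) (s := s) (by positivity)
    (pairWeight_nonneg ed hN hh) (pairWeight_le hed hC.le hNh)
  simp only [openMatrix, probMatrix, vecMul_dotProduct_eq_sum_pairWeight ed N h (fun e => (p e : ℝ))]
  convert h1 using 5 with ω
  exact vecMul_dotProduct_eq_sum_pairWeight ed N h (fun e => propInd (ω e))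

lemma real_openMatrix_lower_tail {ed : T → T → E} (hed : FiberLeTwo ed) (p : E → unitInterval)
    {N h : T → ℝ} (hN : ∀ x, 0 ≤ N x) (hh : ∀ x, 0 ≤ h x) {C s : ℝ} (hC : 0 < C)
    (hNh : ∀ x y, N x * h y ≤ C) (hs : 8 * C * s ≤ (N ᵥ* probMatrix ed p) ⬝ᵥ h) :
    (bernoulliPi p).real {ω | (N ᵥ* openMatrix ed ω) ⬝ᵥ h
      ≤ ((N ᵥ* probMatrix ed p) ⬝ᵥ h) / 4} ≤ Real.exp (-s) := by
  simp only [probMatrix, vecMul_dotProduct_eq_sum_pairWeight ed N h (fun e => (p e : ℝ))] at hs ⊢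
  have h1 := bernoulliPi_real_lower_tail p (pairWeight ed N h) (M := 2 * C) (s := s) (by positivity)
    (pairWeight_nonneg ed hN hh) (pairWeight_le hed hC.le hNh) (by linarith)
  convert h1 using 5 with ω
  exact vecMul_dotProduct_eq_sum_pairWeight ed N h (fun e => propInd (ω e))

/-- Each required bound concerns a linear functional of the new layer whose mean is controlled by
the old profile. The upper tail costs a factor 2 + 2s, the lower tail a factor 4; a union bound over
endpoints and lengths finishes. -/
lemma real_not_walkProfile_succ_le [DecidableEq T] {ed : T → T → E} (hed : FiberLeTwo ed)
    (p : E → unitInterval) {g : ℕ → ℝ} {s X : ℝ} {L : ℕ} {v : T} {j : ℕ} {N : T → ℝ} (hs : 0 ≤ s)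
    (hg : ∀ m x y, (probMatrix ed p ^ m) x y ≤ g m) (hgpos : ∀ m, 0 < g m)
    (hgm : Monotone g) (hgmul : ∀ i k, g i * g k ≤ g (i + k)) (hj : j < L)
    (hX : 8 * ((2 + 2 * s) ^ L * g (L - 1)) * s * 4 ^ L ≤ X)
    (hN : WalkProfile (probMatrix ed p) g (2 + 2 * s) X L v j N) :
    (bernoulliPi p).real {ω | ¬ WalkProfile (probMatrix ed p) g (2 + 2 * s) X L v (j + 1)
      (N ᵥ* openMatrix ed ω)} ≤ ((L + 1) * Fintype.card T + 1) * Real.exp (-s) := by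
  set K : ℝ := 2 + 2 * s with hK
  set A := probMatrix ed p with hA
  have hK0 : 0 < K := by linarith
  have hK1 : 1 ≤ K := by linarith
  -- A walk forced through the pair (x, z) has j free steps before it and k after it: the forced
  -- step contributes nothing to the exponent of `g`.
  have hcoef : ∀ k x z y, N x * (A ^ k) z y ≤ K ^ j * g (j + k) := by
    intro k x z y
    have h1 := hN.upper j le_rfl hj.le x
    rw [Nat.sub_self, pow_zero, vecMul_one] at h1
    calc N x * (A ^ k) z y ≤ (K ^ j * g j) * g k :=
          mul_le_mul h1 (hg _ _ _) (probMatrix_pow_nonneg _ _ _ _ _)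
            (mul_nonneg (pow_pos hK0 _).le (hgpos j).le)
      _ = K ^ j * (g j * g k) := by ring
      _ ≤ _ := mul_le_mul_of_nonneg_left (hgmul j k) (pow_pos hK0 _).le
  have hup : ∀ k y, j + (k + 1) ≤ L → (bernoulliPi p).real
      {ω | K ^ (j + 1) * g (j + (k + 1)) ≤ (N ᵥ* openMatrix ed ω) ⬝ᵥ fun z => (A ^ k) z y}
      ≤ Real.exp (-s) := by
    intro k y hk
    refine le_trans ?_ (real_openMatrix_upper_tail hed p hN.nonneg (h := fun z => (A ^ k) z y)
      (fun z => probMatrix_pow_nonneg _ _ _ _ _) (C := K ^ j * g (j + (k + 1))) (s := s)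
      (mul_pos (pow_pos hK0 _) (hgpos _)) fun x z => (hcoef k x z y).trans
        (mul_le_mul_of_nonneg_left (hgm (by omega)) (pow_pos hK0 _).le))
    refine measureReal_mono fun ω hω => ?_
    rw [Set.mem_ofPred_eq] at hω ⊢
    refine le_trans ?_ hω
    have h2 := hN.upper (j + (k + 1)) (by omega) hk y
    rw [Nat.add_sub_cancel_left, vecMul_pow_succ_apply] at h2
    calc _ ≤ 2 * (K ^ j * g (j + (k + 1))) + 2 * (K ^ j * g (j + (k + 1))) * s := by linarith
      _ = K ^ (j + 1) * g (j + (k + 1)) := by rw [hK]; ring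
  have hlow : (bernoulliPi p).real {ω | (N ᵥ* openMatrix ed ω) ⬝ᵥ (fun z => (A ^ (L - (j + 1))) z v)
      ≤ X / 4 ^ (j + 1)} ≤ Real.exp (-s) := by
    have hL : L - j = L - (j + 1) + 1 := by omega
    have h2 := hN.lower
    rw [hL, vecMul_pow_succ_apply] at h2
    refine le_trans ?_ (real_openMatrix_lower_tail hed p hN.nonneg
      (h := fun z => (A ^ (L - (j + 1))) z v)
      (fun z => probMatrix_pow_nonneg _ _ _ _ _) (C := K ^ L * g (L - 1)) (s := s)
      (mul_pos (pow_pos hK0 _) (hgpos _)) (fun x z => (hcoef _ x z v).trans ?_) ?_)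
    · refine measureReal_mono fun ω hω => ?_
      rw [Set.mem_ofPred_eq] at hω ⊢
      refine hω.trans ?_
      rw [pow_succ, ← div_div]
      exact div_le_div_of_nonneg_right h2 (by norm_num)
    -- This lost step is why `hX` compares `X` with `g (L - 1)` and not with `g L`.
    · rw [show j + (L - (j + 1)) = L - 1 by omega]
      exact mul_le_mul_of_nonneg_right (pow_le_pow_right₀ hK1 hj.le) (hgpos _).le
    · refine le_trans ?_ h2
      rw [le_div_iff₀ (by positivity)]
      refine le_trans ?_ hX
      refine mul_le_mul_of_nonneg_left (pow_le_pow_right₀ (by norm_num) hj.le) ?_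
      exact mul_nonneg (mul_nonneg (by norm_num) (mul_pos (pow_pos hK0 _) (hgpos _)).le) hs
  have hsub : {ω | ¬ WalkProfile A g K X L v (j + 1) (N ᵥ* openMatrix ed ω)} ⊆
      (⋃ k : Fin (L + 1), ⋃ y : T, {ω | j + ((k : ℕ) + 1) ≤ L ∧ K ^ (j + 1) * g (j + (k + 1)) ≤
        (N ᵥ* openMatrix ed ω) ⬝ᵥ fun z => (A ^ (k : ℕ)) z y}) ∪
      {ω | (N ᵥ* openMatrix ed ω) ⬝ᵥ (fun z => (A ^ (L - (j + 1))) z v) ≤ X / 4 ^ (j + 1)} := by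
    intro ω hω
    by_contra hcon
    simp only [Set.mem_union, Set.mem_iUnion, Set.mem_ofPred_eq, not_or, not_exists, not_and,
      not_le] at hcon
    refine hω ⟨vecMul_openMatrix_nonneg ed ω hN.nonneg, fun m hm hmL y => ?_, hcon.2.le⟩
    have h3 := hcon.1 ⟨m - (j + 1), by omega⟩ y
    simp only [show j + (m - (j + 1) + 1) = m by omega] at h3
    exact (h3 hmL).le
  refine (measureReal_mono hsub).trans ((measureReal_union_le _ _).trans ?_)
  rw [add_mul, one_mul]
  refine add_le_add ?_ hlow
  refine (measureReal_iUnion_fintype_le _).trans ?_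
  refine (Finset.sum_le_card_nsmul _ _ (Fintype.card T * Real.exp (-s)) fun k _ => ?_).trans
    (le_of_eq (by simp [mul_assoc]))
  refine (measureReal_iUnion_fintype_le _).trans ?_
  refine (Finset.sum_le_card_nsmul _ _ (Real.exp (-s)) fun y _ => ?_).trans
    (le_of_eq (by simp))
  by_cases hk : j + ((k : ℕ) + 1) ≤ L
  · simpa [hk] using hup k y hk
  · simpa [hk] using (Real.exp_pos _).le

/-- Fubini, used to condition on the earlier layers. -/
lemma measureReal_prod_le_of_forall {α β : Type*} [MeasurableSpace α] [MeasurableSpace β]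
    (μ : Measure α) (ν : Measure β) [IsProbabilityMeasure μ] [IsProbabilityMeasure ν]
    {s : Set (α × β)} (hs : MeasurableSet s) {ε : ℝ} (hε : 0 ≤ ε)
    (h : ∀ x, ν.real (Prod.mk x ⁻¹' s) ≤ ε) : (μ.prod ν).real s ≤ ε := by
  refine ENNReal.toReal_le_of_le_ofReal hε ?_
  rw [Measure.prod_apply hs]
  calc _ ≤ ∫⁻ _, ENNReal.ofReal ε ∂μ :=
        lintegral_mono fun x => (ENNReal.le_ofReal_iff_toReal_le (measure_ne_top _ _) hε).2 (h x)
    _ = _ := by simp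

/-- Among `j` superimposed independent layers of edges there is, with high probability, a
plausible vector of walk numbers that is supported on the vertices at distance at most `j`
from `u`. -/
lemma real_not_exists_walkProfile_le [DecidableEq T] {ed : T → T → E} (hed : FiberLeTwo ed)
    (p : ℕ → E → unitInterval) (q : E → unitInterval)
    (hp : ∀ j e, 1 - (p j e : ℝ) = (1 - q e) ^ j) {g : ℕ → ℝ} {s X : ℝ} {L : ℕ} {u v : T}
    (hs : 0 ≤ s) (hg : ∀ m x y, (probMatrix ed q ^ m) x y ≤ g m) (hgpos : ∀ m, 0 < g m)
    (hgm : Monotone g) (hgmul : ∀ i k, g i * g k ≤ g (i + k))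
    (hX : 8 * ((2 + 2 * s) ^ L * g (L - 1)) * s * 4 ^ L ≤ X)
    (hXA : X ≤ (probMatrix ed q ^ L) u v) {j : ℕ} (hj : j ≤ L) :
    (bernoulliPi (p j)).real {ω | ¬ ∃ N, WalkProfile (probMatrix ed q) g (2 + 2 * s) X L v j N ∧
      ∀ x, N x ≠ 0 → (openGraph ed ω).edist u x ≤ j}
      ≤ j * (((L + 1) * Fintype.card T + 1) * Real.exp (-s)) := by
  set ε := ((L + 1) * Fintype.card T + 1) * Real.exp (-s) with hε
  have hε0 : 0 ≤ ε := by positivity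
  induction j with
  | zero =>
    refine le_of_eq ?_
    rw [show ((0 : ℕ) : ℝ) * ε = 0 by simp]
    convert measureReal_empty
    rw [Set.eq_empty_iff_forall_notMem]
    intro ω hω
    refine hω ⟨Pi.single u 1, ⟨fun x => ?_, fun m _ _ y => ?_, ?_⟩, fun x hx => ?_⟩
    · rw [Pi.single_apply]; split_ifs <;> norm_num
    · simpa using hg m u y
    · simpa using hXA
    · have : x = u := by
        by_contra hne
        exact hx (Pi.single_eq_of_ne hne _)
      simp [this]
  | succ j ih =>
    have hor := map_or_bernoulliPi (p j) q (p (j + 1)) fun e => by rw [hp, hp, pow_succ]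
    set Good : (E → Prop) → (T → ℝ) → Prop := fun ω N =>
      WalkProfile (probMatrix ed q) g (2 + 2 * s) X L v j N ∧
      ∀ x, N x ≠ 0 → (openGraph ed ω).edist u x ≤ j with hGood
    -- The profile must be a function of the earlier layers alone, so that the new layer is
    -- independent of it; the value 0 on bad outcomes is never used.
    have hchoose : ∀ ω, ∃ N, (∃ N', Good ω N') → Good ω N := fun ω => by
      by_cases h : ∃ N', Good ω N'
      · exact ⟨h.choose, fun _ => h.choose_spec⟩
      · exact ⟨0, fun h' => absurd h' h⟩
    choose F hF using hchoose
    have hmeas : ∀ s : Set ((E → Prop) × (E → Prop)), MeasurableSet s := fun s =>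
      s.toFinite.measurableSet
    rw [← hor, map_measureReal_apply (measurable_of_finite _) (Set.toFinite _).measurableSet]
    have hsub : (fun ω : (E → Prop) × (E → Prop) => fun e => ω.1 e ∨ ω.2 e) ⁻¹'
        {ω | ¬ ∃ N, WalkProfile (probMatrix ed q) g (2 + 2 * s) X L v (j + 1) N ∧
          ∀ x, N x ≠ 0 → (openGraph ed ω).edist u x ≤ (j + 1 : ℕ)} ⊆
        ({ω | ¬ ∃ N, Good ω N} ×ˢ Set.univ) ∪
        {z | (∃ N, Good z.1 N) ∧ ¬ WalkProfile (probMatrix ed q) g (2 + 2 * s) X L v (j + 1)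
          (F z.1 ᵥ* openMatrix ed z.2)} := by
      rintro ⟨ω, ω'⟩ hω
      by_contra hcon
      simp only [Set.mem_union, Set.mem_prod, Set.mem_ofPred_eq, Set.mem_univ, and_true, not_or,
        not_not, not_and] at hcon
      refine hω ⟨_, hcon.2 hcon.1, fun y hy => ?_⟩
      obtain ⟨x, -, hx⟩ := Finset.exists_ne_zero_of_sum_ne_zero hy
      have hx1 := (hF ω hcon.1).2 x (left_ne_zero_of_mul hx)
      have hxy : ω' (ed x y) := of_propInd_ne_zero (right_ne_zero_of_mul hx)
      refine (SimpleGraph.edist_triangle (v := x)).trans ?_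
      rw [Nat.cast_add, Nat.cast_one]
      refine add_le_add ((SimpleGraph.edist_anti (openGraph_mono ed fun e he => Or.inl he)).trans hx1) ?_
      rw [SimpleGraph.edist_le_one_iff_adj_or_eq]
      -- A walk may stay put, since diagonal entries of the open matrix can be nonzero; such a step
      -- costs no distance.
      by_cases hne : x = y
      · exact Or.inr hne
      · left
        rw [openGraph, SimpleGraph.fromRel_adj]
        exact ⟨hne, Or.inl (Or.inr hxy)⟩
    refine (measureReal_mono hsub).trans ((measureReal_union_le _ _).trans ?_)
    rw [Nat.cast_add, Nat.cast_one, add_mul, one_mul]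
    refine add_le_add ?_ (measureReal_prod_le_of_forall _ _ (hmeas _) hε0 fun ω => ?_)
    · rw [measureReal_prod_prod, probReal_univ, mul_one]
      exact ih (by omega)
    · by_cases h : ∃ N, Good ω N
      · refine le_trans (measureReal_mono ?_)
          (real_not_walkProfile_succ_le hed q hs hg hgpos hgm hgmul (by omega) hX (hF ω h).1)
        exact fun ω' hω' => hω'.2
      · refine le_trans (le_of_eq ?_) hε0
        convert measureReal_empty
        rw [Set.eq_empty_iff_forall_notMem]
        exact fun ω' hω' => h hω'.1

/-- After all L layers the lower bound of the profile says that its entry at `v` is positive, so `v`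
lies in the support and hence within distance L of `u`. -/
lemma real_lt_edist_le [DecidableEq T] {ed : T → T → E} (hed : FiberLeTwo ed)
    (p q : E → unitInterval) {L : ℕ} (hp : ∀ e, 1 - (p e : ℝ) = (1 - q e) ^ L) {g : ℕ → ℝ} {s : ℝ}
    {u v : T} (hs : 0 < s) (hg : ∀ m x y, (probMatrix ed q ^ m) x y ≤ g m) (hgpos : ∀ m, 0 < g m)
    (hgm : Monotone g) (hgmul : ∀ i k, g i * g k ≤ g (i + k))
    (hX : 8 * ((2 + 2 * s) ^ L * g (L - 1)) * s * 4 ^ L ≤ (probMatrix ed q ^ L) u v) :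
    (bernoulliPi p).real {ω | (L : ℕ∞) < (openGraph ed ω).edist u v}
      ≤ L * (((L + 1) * Fintype.card T + 1) * Real.exp (-s)) := by
  have hmem : ∀ (j : ℕ) (e : E), 1 - (1 - (q e : ℝ)) ^ j ∈ unitInterval := fun j e => by
    have h0 : 0 ≤ 1 - (q e : ℝ) := by linarith [(q e).2.2]
    have h1 : 1 - (q e : ℝ) ≤ 1 := by linarith [(q e).2.1]
    exact ⟨by linarith [pow_le_one₀ h0 h1 (n := j)], by linarith [pow_nonneg h0 j]⟩
  have h := real_not_exists_walkProfile_le hed (fun j e => ⟨_, hmem j e⟩) q (fun j e => by simp)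
    hs.le hg hgpos hgm hgmul hX le_rfl (le_refl L)
  have hpL : (fun e => (⟨_, hmem L e⟩ : unitInterval)) = p := by
    funext e
    ext
    linarith [hp e]
  simp only [hpL] at h
  refine le_trans (measureReal_mono ?_) h
  intro ω hω hex
  obtain ⟨N, hN, hsupp⟩ := hex
  refine absurd (hsupp v ?_) (not_le.2 hω)
  have h1 := hN.lower
  rw [Nat.sub_self, pow_zero, vecMul_one] at h1
  refine (lt_of_lt_of_le (div_pos (lt_of_lt_of_le ?_ hX) (by positivity)) h1).ne'
  have := hgpos (L - 1)
  positivity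

end Growth

/-! ### Entries and row sums of powers of nonnegative matrices. -/

section MatrixBounds

open Matrix

variable {T : Type*} [Fintype T] [DecidableEq T]

lemma matrix_pow_nonneg {A : Matrix T T ℝ} (hA : ∀ x y, 0 ≤ A x y) (m : ℕ) (x y : T) :
    0 ≤ (A ^ m) x y := by
  induction m generalizing x y with
  | zero => rw [pow_zero, Matrix.one_apply]; split_ifs <;> norm_num
  | succ m ih =>
    rw [pow_succ, Matrix.mul_apply]
    exact Finset.sum_nonneg fun z _ => mul_nonneg (ih _ _) (hA _ _)

lemma pow_mul_matrix_pow_le {A W : Matrix T T ℝ} {c : ℝ} (hc : 0 ≤ c) (hW : ∀ x y, 0 ≤ W x y)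
    (hWA : ∀ x y, c * W x y ≤ A x y) (m : ℕ) (x y : T) : c ^ m * (W ^ m) x y ≤ (A ^ m) x y := by
  have hA : ∀ x y, 0 ≤ A x y := fun x y => (mul_nonneg hc (hW x y)).trans (hWA x y)
  induction m generalizing x y with
  | zero => simp
  | succ m ih =>
    rw [pow_succ, pow_succ W, pow_succ A, Matrix.mul_apply, Matrix.mul_apply, Finset.mul_sum]
    refine Finset.sum_le_sum fun z _ => ?_
    calc c ^ m * c * ((W ^ m) x z * W z y) = (c ^ m * (W ^ m) x z) * (c * W z y) := by ring
      _ ≤ _ := mul_le_mul (ih _ _) (hWA _ _) (mul_nonneg hc (hW _ _)) (matrix_pow_nonneg hA _ _ _)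

lemma pow_le_rowSum_matrix_pow {W : Matrix T T ℝ} {R : ℝ} (hR : 0 ≤ R) (hW : ∀ x y, 0 ≤ W x y)
    (hrow : ∀ x, R ≤ ∑ y, W x y) (m : ℕ) (x : T) : R ^ m ≤ ∑ y, (W ^ m) x y := by
  induction m generalizing x with
  | zero => simp [Matrix.one_apply]
  | succ m ih =>
    have h1 : ∑ y, (W ^ (m + 1)) x y = ∑ z, W x z * ∑ y, (W ^ m) z y := by
      simp_rw [pow_succ', Matrix.mul_apply, Finset.mul_sum]
      exact Finset.sum_comm
    rw [h1, pow_succ']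
    calc R * R ^ m ≤ (∑ z, W x z) * R ^ m := mul_le_mul_of_nonneg_right (hrow x) (pow_nonneg hR _)
      _ = ∑ z, W x z * R ^ m := Finset.sum_mul ..
      _ ≤ _ := Finset.sum_le_sum fun z _ => mul_le_mul_of_nonneg_left (ih z) (hW _ _)

/-- By symmetry the diagonal entry is the sum of squares of a row of W^m; Cauchy–Schwarz compares it
with the row sum. This is why walks of even length are used. -/
lemma pow_le_card_mul_matrix_pow_diag {W : Matrix T T ℝ} {R : ℝ} (hR : 0 ≤ R)
    (hW : ∀ x y, 0 ≤ W x y) (hsymm : W.IsSymm) (hrow : ∀ x, R ≤ ∑ y, W x y) (m : ℕ) (x : T) :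
    R ^ (2 * m) ≤ Fintype.card T * (W ^ (2 * m)) x x := by
  have h1 : (W ^ (2 * m)) x x = ∑ z, (W ^ m) x z ^ 2 := by
    rw [two_mul, pow_add, Matrix.mul_apply]
    refine Finset.sum_congr rfl fun z _ => ?_
    rw [sq, (hsymm.pow m).apply x z]
  rw [h1, mul_comm 2 m, pow_mul]
  calc (R ^ m) ^ 2 ≤ (∑ z, (W ^ m) x z) ^ 2 :=
        pow_le_pow_left₀ (pow_nonneg hR _) (pow_le_rowSum_matrix_pow hR hW hrow m x) 2
    _ ≤ _ := sq_sum_le_card_mul_sum_sq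

end MatrixBounds

/-- Take q = 1 - (1 - p)^(1/L); Bernoulli's inequality gives q ≥ p/L, so thinning costs only a
constant factor per step. -/
lemma exists_unitInterval_layer (p : unitInterval) {L : ℕ} (hL : L ≠ 0) :
    ∃ q : unitInterval, 1 - (p : ℝ) = (1 - q) ^ L ∧ (L : ℝ)⁻¹ * p ≤ q ∧ q ≤ p := by
  have h0 : 0 ≤ 1 - (p : ℝ) := by linarith [p.2.2]
  have h1 : 1 - (p : ℝ) ≤ 1 := by linarith [p.2.1]
  set t : ℝ := (1 - (p : ℝ)) ^ ((L : ℝ)⁻¹) with ht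
  have htL : t ^ L = 1 - p := Real.rpow_inv_natCast_pow h0 hL
  have ht0 : 0 ≤ t := Real.rpow_nonneg h0 _
  have ht1 : t ≤ 1 := Real.rpow_le_one h0 h1 (by positivity)
  refine ⟨⟨1 - t, by linarith, by linarith⟩, by simp [htL], ?_, ?_⟩
  · have hb := one_add_mul_le_pow (a := t - 1) (by linarith) L
    rw [add_sub_cancel, htL] at hb
    have hLpos : (0 : ℝ) < L := by exact_mod_cast Nat.pos_of_ne_zero hL
    rw [inv_mul_le_iff₀ hLpos]
    simp only
    linarith
  · rw [← Subtype.coe_le_coe]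
    have := pow_le_of_le_one ht0 ht1 hL
    simp only
    linarith

/-! ### Walk weights on the cube and its middle layer. -/

section Cube

variable {n : ℕ}

/-- The weight `α ^ (n - d) * β ^ d` of a pair of vertices at Hamming distance `d`. -/
noncomputable def pairProb (α β : ℝ) (x y : KVertex n) : ℝ := ∏ i, if x i = y i then α else β

lemma pairProb_nonneg {α β : ℝ} (hα : 0 ≤ α) (hβ : 0 ≤ β) (x y : KVertex n) :
    0 ≤ pairProb α β x y :=
  Finset.prod_nonneg fun i _ => by split_ifs <;> assumption

lemma pairProb_comm (α β : ℝ) (x y : KVertex n) : pairProb α β x y = pairProb α β y x :=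
  Finset.prod_congr rfl fun i _ => by simp only [eq_comm]

lemma coe_kEdgeProb (α β : unitInterval) (x y : KVertex n) :
    (kEdgeProb α β α n s(x, y) : ℝ) = pairProb α β x y := by
  have h : ∀ i j : Fin 2, (kInitiator α β α i j : ℝ) = if i = j then (α : ℝ) else β := by
    intro i j
    fin_cases i <;> fin_cases j <;> simp [kInitiator]
  have hprod : ∀ f : Fin n → unitInterval, ((∏ i, f i : unitInterval) : ℝ) = ∏ i, (f i : ℝ) :=
    fun f => map_prod (unitInterval.submonoid.subtype) f _
  rw [kEdgeProb, Sym2.lift_mk, hprod]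
  exact Finset.prod_congr rfl fun i _ => h _ _

/-- The `2 × 2` matrix with `α` on the diagonal and `β` off the diagonal. -/
def coordMatrix (α β : ℝ) : Matrix (Fin 2) (Fin 2) ℝ := Matrix.of fun i j => if i = j then α else β

lemma coordMatrix_nonneg {α β : ℝ} (hα : 0 ≤ α) (hβ : 0 ≤ β) (i j : Fin 2) :
    0 ≤ coordMatrix α β i j := by
  rw [coordMatrix, Matrix.of_apply]; split_ifs <;> assumption

/-- Sum and difference of the two entries are the eigenvalues (α + β)^m and (α - β)^m of the power;
the second is at most 1 in absolute value. -/
lemma exists_coordMatrix_pow_eq {α β : ℝ} (h : |α - β| ≤ 1) (m : ℕ) :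
    ∃ s d : ℝ, coordMatrix α β ^ m = coordMatrix s d ∧ s + d = (α + β) ^ m ∧ |s - d| ≤ 1 := by
  induction m with
  | zero =>
    refine ⟨1, 0, ?_, by simp, by simp⟩
    ext i j
    simp [coordMatrix, Matrix.one_apply]
  | succ m ih =>
    obtain ⟨s, d, hsd, hadd, hsub⟩ := ih
    refine ⟨s * α + d * β, s * β + d * α, ?_, by rw [pow_succ, ← hadd]; ring, ?_⟩
    · rw [pow_succ, hsd]
      ext i j
      fin_cases i <;> fin_cases j <;>
        simp [coordMatrix, Matrix.mul_apply, Fin.sum_univ_two] <;> ring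
    · rw [show s * α + d * β - (s * β + d * α) = (s - d) * (α - β) by ring, abs_mul]
      exact mul_le_one₀ hsub (abs_nonneg _) h

lemma coordMatrix_pow_le {α β : ℝ} (h : |α - β| ≤ 1) (m : ℕ) (i j : Fin 2) :
    (coordMatrix α β ^ m) i j ≤ ((α + β) ^ m + 1) / 2 := by
  obtain ⟨s, d, hsd, hadd, hsub⟩ := exists_coordMatrix_pow_eq h m
  rw [hsd, coordMatrix, Matrix.of_apply, ← hadd]
  have := abs_le.1 hsub
  split_ifs <;> linarith

/-- Letting walks leave S only increases their weight, and on the whole cube the sum over walks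
factors over coordinates. -/
lemma matrix_pow_le_prod_coordMatrix_pow {α β : ℝ} (hα : 0 ≤ α) (hβ : 0 ≤ β)
    {S : Set (KVertex n)} [Fintype S] [DecidableEq S] {A : Matrix S S ℝ} (hA : ∀ x y, 0 ≤ A x y)
    (hAW : ∀ x y : S, A x y ≤ pairProb α β x.1 y.1) (m : ℕ) (x y : S) :
    (A ^ m) x y ≤ ∏ i, (coordMatrix α β ^ m) (x.1 i) (y.1 i) := by
  have hP := matrix_pow_nonneg (coordMatrix_nonneg hα hβ)
  induction m generalizing x y with
  | zero =>
    rw [pow_zero, pow_zero, Matrix.one_apply]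
    split_ifs with h
    · subst h
      simp
    · exact Finset.prod_nonneg fun i _ => by
        rw [Matrix.one_apply]; split_ifs <;> norm_num
  | succ m ih =>
    rw [pow_succ, pow_succ, Matrix.mul_apply]
    simp_rw [Matrix.mul_apply]
    rw [Finset.prod_univ_sum, Fintype.piFinset_univ]
    set f : KVertex n → ℝ := fun z =>
      ∏ i, (coordMatrix α β ^ m) (x.1 i) (z i) * coordMatrix α β (z i) (y.1 i) with hf
    have hf0 : ∀ z, 0 ≤ f z := fun z => Finset.prod_nonneg fun i _ =>
      mul_nonneg (hP _ _ _) (coordMatrix_nonneg hα hβ _ _)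
    calc ∑ z : S, (A ^ m) x z * A z y ≤ ∑ z : S, f z.1 := by
          refine Finset.sum_le_sum fun z _ => ?_
          rw [hf]
          simp only
          rw [Finset.prod_mul_distrib]
          exact mul_le_mul (ih x z) (hAW z y) (hA _ _) (Finset.prod_nonneg fun i _ => hP _ _ _)
      _ = ∑ z ∈ Finset.univ.map (Function.Embedding.subtype (· ∈ S)), f z := by
          rw [Finset.sum_map]; rfl
      _ ≤ ∑ z, f z := Finset.sum_le_sum_of_subset_of_nonneg (Finset.subset_univ _)
          fun z _ _ => hf0 z

lemma matrix_pow_le_pow {α β : ℝ} (hα : 0 ≤ α) (hβ : 0 ≤ β) (h : |α - β| ≤ 1)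
    {S : Set (KVertex n)} [Fintype S] [DecidableEq S] {A : Matrix S S ℝ} (hA : ∀ x y, 0 ≤ A x y)
    (hAW : ∀ x y : S, A x y ≤ pairProb α β x.1 y.1) (m : ℕ) (x y : S) :
    (A ^ m) x y ≤ (((α + β) ^ m + 1) / 2) ^ n := by
  refine (matrix_pow_le_prod_coordMatrix_pow hα hβ hA hAW m x y).trans ?_
  refine (Finset.prod_le_prod (fun i _ => matrix_pow_nonneg (coordMatrix_nonneg hα hβ) _ _ _)
    fun i _ => coordMatrix_pow_le h m _ _).trans (le_of_eq ?_)
  rw [Finset.prod_const, Finset.card_univ, Fintype.card_fin]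

/-- Each coordinate where x and y differ swaps a factor α with a factor β, which loses at most r. -/
lemma pow_hammingDist_mul_pairProb_le {α β r : ℝ} (hα : 0 ≤ α) (hβ : 0 ≤ β) (hr : 0 ≤ r)
    (h1 : r * α ≤ β) (h2 : r * β ≤ α) (x y z : KVertex n) :
    r ^ hammingDist x y * pairProb α β y z ≤ pairProb α β x z := by
  have h3 : r ^ hammingDist x y = ∏ i, if x i = y i then 1 else r := by
    rw [hammingDist, Finset.prod_ite, Finset.prod_const, Finset.prod_const, one_pow, one_mul]
  rw [h3, pairProb, pairProb, ← Finset.prod_mul_distrib]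
  refine Finset.prod_le_prod (fun i _ => ?_) fun i _ => ?_
  · split_ifs <;> positivity
  · by_cases hxy : x i = y i
    · simp [hxy]
    · by_cases hyz : y i = z i
      · have : x i ≠ z i := fun h => hxy (h.trans hyz.symm)
        simpa [hxy, hyz, this] using h1
      · have : x i = z i := by omega
        simpa [hyz, this, eq_comm] using h2

/-- Replacing the starting point alters only the first step of a walk, so the loss does not grow
with m. -/
lemma pow_hammingDist_mul_matrix_pow_le {α β r : ℝ} (hα : 0 ≤ α) (hβ : 0 ≤ β) (hr : 0 ≤ r)
    (h1 : r * α ≤ β) (h2 : r * β ≤ α) {S : Set (KVertex n)} [Fintype S] [DecidableEq S] {m : ℕ}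
    (hm : m ≠ 0) (x y z : S) :
    r ^ hammingDist x.1 y.1 * ((Matrix.of fun x y : S => pairProb α β x.1 y.1) ^ m) y z
      ≤ ((Matrix.of fun x y : S => pairProb α β x.1 y.1) ^ m) x z := by
  obtain ⟨m, rfl⟩ := Nat.exists_eq_succ_of_ne_zero hm
  rw [Nat.succ_eq_add_one, pow_succ', Matrix.mul_apply, Matrix.mul_apply, Finset.mul_sum]
  refine Finset.sum_le_sum fun w _ => ?_
  rw [← mul_assoc]
  refine mul_le_mul_of_nonneg_right ?_
    (matrix_pow_nonneg (A := Matrix.of fun x y : S => pairProb α β x.1 y.1)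
      (fun x y => pairProb_nonneg hα hβ x.1 y.1) _ _ _)
  exact pow_hammingDist_mul_pairProb_le hα hβ hr h1 h2 _ _ _

/-- The vertex obtained from `x` by flipping the coordinates in `F`. -/
def flipOn (x : KVertex n) (F : Finset (Fin n)) : KVertex n :=
  fun i => if i ∈ F then 1 - x i else x i

lemma flipOn_apply_ne_iff (x : KVertex n) (F : Finset (Fin n)) (i : Fin n) :
    x i ≠ flipOn x F i ↔ i ∈ F := by
  rw [flipOn]
  split_ifs with h
  · simp only [h, iff_true]; omega
  · simp [h]

lemma flipOn_injective (x : KVertex n) : Function.Injective (flipOn x) := by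
  intro F F' h
  ext i
  rw [← flipOn_apply_ne_iff x F, ← flipOn_apply_ne_iff x F', h]

lemma pairProb_flipOn (α β : ℝ) (x : KVertex n) (F : Finset (Fin n)) :
    pairProb α β x (flipOn x F) = α ^ (n - F.card) * β ^ F.card := by
  have h : ∀ i, (if x i = flipOn x F i then α else β) = if i ∈ F then β else α := fun i => by
    have := flipOn_apply_ne_iff x F i
    by_cases hi : i ∈ F
    · rw [if_pos hi, if_neg (this.2 hi)]
    · rw [if_neg hi, if_pos (not_not.1 (mt this.1 hi))]
  rw [pairProb, Finset.prod_congr rfl fun i _ => h i, Finset.prod_ite, Finset.prod_const,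
    Finset.prod_const, mul_comm, Finset.filter_not, Finset.filter_mem_eq_inter, Finset.univ_inter,
    Finset.card_sdiff_of_subset (Finset.subset_univ _), Finset.card_univ, Fintype.card_fin]

lemma kWeight_add_card {x y : KVertex n} {A B : Finset (Fin n)}
    (h : ∀ i, (x i : ℕ) + (if i ∈ B then 1 else 0) = y i + if i ∈ A then 1 else 0) :
    kWeight x + B.card = kWeight y + A.card := by
  have := Finset.sum_congr rfl fun i (_ : i ∈ Finset.univ) => h i
  simpa [Finset.sum_add_distrib, kWeight] using this

lemma kWeight_flipOn {x : KVertex n} {A B : Finset (Fin n)} (hA : ∀ i ∈ A, x i = 1)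
    (hB : ∀ i ∈ B, x i = 0) (hAB : A.card = B.card) : kWeight (flipOn x (A ∪ B)) = kWeight x := by
  have h := kWeight_add_card (x := x) (y := flipOn x (A ∪ B)) (A := A) (B := B) fun i => by
    have hAi := hA i
    have hBi := hB i
    rw [flipOn]
    by_cases h1 : i ∈ A <;> by_cases h2 : i ∈ B <;> simp_all
  omega

lemma card_filter_eq_one (x : KVertex n) :
    (Finset.univ.filter fun i => x i = 1).card = kWeight x := by
  rw [Finset.card_filter, kWeight]
  refine Finset.sum_congr rfl fun i _ => ?_
  have : ∀ a : Fin 2, (if a = 1 then 1 else 0) = (a : ℕ) := by decide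
  exact this _

lemma card_filter_eq_one_of_mem {x : KVertex n} (hx : x ∈ kMiddleLayer n) :
    (Finset.univ.filter fun i => x i = 1).card = n / 2 := by
  have : 2 * kWeight x = n := hx
  rw [card_filter_eq_one]
  omega

lemma card_filter_eq_zero_of_mem {x : KVertex n} (hx : x ∈ kMiddleLayer n) :
    (Finset.univ.filter fun i => x i = 0).card = n / 2 := by
  have h0 : 2 * kWeight x = n := hx
  have h := Finset.card_filter_add_card_filter_not (s := Finset.univ) (p := fun i => x i = 1)
  have h1 : (Finset.univ.filter fun i => ¬ x i = 1) = Finset.univ.filter fun i => x i = 0 :=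
    Finset.filter_congr fun i _ => by omega
  rw [h1, card_filter_eq_one, Finset.card_univ, Fintype.card_fin] at h
  omega

/-- Flipping k ones and k zeros stays in the layer. With m = n/2 these flips contribute ∑ₖ (C(m,k)
α^(m-k) β^k)², which by Cauchy–Schwarz is at least (α + β)^(2m)/(m + 1). -/
lemma pow_le_rowSum_pairProb {α β : ℝ} (hα : 0 ≤ α) (hβ : 0 ≤ β) [Fintype (kMiddleLayer n)]
    (x : kMiddleLayer n) :
    (α + β) ^ n / (n + 1) ≤ ∑ y : kMiddleLayer n, pairProb α β x.1 y.1 := by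
  have hn : 2 * kWeight x.1 = n := x.2
  set m := n / 2 with hm
  have hnm : n = 2 * m := by omega
  set O := Finset.univ.filter fun i => x.1 i = 1 with hO
  set Z := Finset.univ.filter fun i => x.1 i = 0 with hZ
  have hOc : O.card = m := card_filter_eq_one_of_mem x.2
  have hZc : Z.card = m := card_filter_eq_zero_of_mem x.2
  set I := (Finset.range (m + 1)).sigma fun k => O.powersetCard k ×ˢ Z.powersetCard k with hI
  have hImem : ∀ t ∈ I, (t.2.1 ⊆ O ∧ t.2.1.card = t.1) ∧ (t.2.2 ⊆ Z ∧ t.2.2.card = t.1) := by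
    intro t ht
    rw [hI, Finset.mem_sigma, Finset.mem_product, Finset.mem_powersetCard,
      Finset.mem_powersetCard] at ht
    exact ht.2
  have hOZ : Disjoint O Z := Finset.disjoint_filter.2 fun i _ h => by omega
  have hcardU : ∀ t ∈ I, (t.2.1 ∪ t.2.2).card = 2 * t.1 := fun t ht => by
    obtain ⟨⟨h1, h2⟩, h3, h4⟩ := hImem t ht
    rw [Finset.card_union_of_disjoint (Finset.disjoint_of_subset_left h1
      (Finset.disjoint_of_subset_right h3 hOZ)), h2, h4, two_mul]
  have hinj : Set.InjOn (fun t : (_ : ℕ) × (Finset (Fin n) × Finset (Fin n)) =>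
      flipOn x.1 (t.2.1 ∪ t.2.2)) I := by
    rintro ⟨k, A, B⟩ ht ⟨k', A', B'⟩ ht' h
    obtain ⟨⟨h1, h2⟩, h3, h4⟩ := hImem _ ht
    obtain ⟨⟨h1', h2'⟩, h3', h4'⟩ := hImem _ ht'
    simp only at h h1 h2 h3 h4 h1' h2' h3' h4'
    have hU := flipOn_injective _ h
    have hdis := Finset.disjoint_left.1 hOZ
    have hAA : A = A' := by
      ext i
      have := Finset.ext_iff.1 hU i
      simp only [Finset.mem_union] at this
      exact ⟨fun hi => (this.1 (Or.inl hi)).resolve_right fun hb => hdis (h1 hi) (h3' hb),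
        fun hi => (this.2 (Or.inl hi)).resolve_right fun hb => hdis (h1' hi) (h3 hb)⟩
    have hBB : B = B' := by
      ext i
      have := Finset.ext_iff.1 hU i
      simp only [Finset.mem_union] at this
      exact ⟨fun hi => (this.1 (Or.inr hi)).resolve_left fun hb => hdis (h1' hb) (h3 hi),
        fun hi => (this.2 (Or.inr hi)).resolve_left fun hb => hdis (h1 hb) (h3' hi)⟩
    subst hAA hBB
    rw [h2] at h2'
    subst h2'
    rfl
  have hsum : ∑ k ∈ Finset.range (m + 1), (β ^ k * α ^ (m - k) * m.choose k) ^ 2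
      ≤ ∑ y : kMiddleLayer n, pairProb α β x.1 y.1 := by
    calc _ = ∑ t ∈ I, pairProb α β x.1 (flipOn x.1 (t.2.1 ∪ t.2.2)) := by
          rw [hI, Finset.sum_sigma]
          refine Finset.sum_congr rfl fun k hk => ?_
          have hk' : k ≤ m := by simpa [Nat.lt_succ_iff] using hk
          rw [Finset.sum_congr rfl (g := fun _ => α ^ (n - 2 * k) * β ^ (2 * k)) fun t ht => by
            rw [pairProb_flipOn, hcardU ⟨k, t⟩ (Finset.mem_sigma.2 ⟨hk, ht⟩)]]
          rw [Finset.sum_const, Finset.card_product, Finset.card_powersetCard,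
            Finset.card_powersetCard, hOc, hZc, nsmul_eq_mul,
            show n - 2 * k = 2 * (m - k) by omega]
          push_cast
          ring
      _ = ∑ y ∈ I.image fun t => flipOn x.1 (t.2.1 ∪ t.2.2), pairProb α β x.1 y := by
          rw [Finset.sum_image hinj]
      _ ≤ ∑ y ∈ Finset.univ.map (Function.Embedding.subtype (· ∈ kMiddleLayer n)),
            pairProb α β x.1 y := by
          refine Finset.sum_le_sum_of_subset_of_nonneg ?_ fun _ _ _ => pairProb_nonneg hα hβ _ _
          intro y hy
          obtain ⟨t, ht, rfl⟩ := Finset.mem_image.1 hy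
          obtain ⟨⟨h1, h2⟩, h3, h4⟩ := hImem t ht
          rw [Finset.mem_map]
          refine ⟨⟨flipOn x.1 (t.2.1 ∪ t.2.2), ?_⟩, Finset.mem_univ _, rfl⟩
          change 2 * kWeight (flipOn x.1 (t.2.1 ∪ t.2.2)) = n
          rw [kWeight_flipOn (fun i hi => (Finset.mem_filter.1 (h1 hi)).2)
            (fun i hi => (Finset.mem_filter.1 (h3 hi)).2) (h2.trans h4.symm)]
          exact hn
      _ = _ := by rw [Finset.sum_map]; rfl
  refine le_trans ?_ hsum
  have hcs := sq_sum_le_card_mul_sum_sq (s := Finset.range (m + 1))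
    (f := fun k => β ^ k * α ^ (m - k) * (m.choose k : ℝ))
  rw [← add_pow, ← pow_mul, Finset.card_range, mul_comm m 2, ← hnm, add_comm β α] at hcs
  rw [div_le_iff₀ (by positivity)]
  refine hcs.trans ?_
  rw [mul_comm]
  refine mul_le_mul_of_nonneg_left ?_ (Finset.sum_nonneg fun _ _ => sq_nonneg _)
  exact_mod_cast (by omega : m + 1 ≤ n + 1)

/-- Vertices of the middle layer can be joined through it in short Hamming steps. -/
lemma exists_mem_kMiddleLayer_hammingDist_le {x y : KVertex n} (hx : x ∈ kMiddleLayer n)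
    (hy : y ∈ kMiddleLayer n) {h t : ℕ} (hxy : hammingDist x y ≤ (t + 1) * (2 * h)) :
    ∃ w ∈ kMiddleLayer n, hammingDist x w ≤ 2 * h ∧ hammingDist w y ≤ t * (2 * h) := by
  have hx' : 2 * kWeight x = n := hx
  have hy' : 2 * kWeight y = n := hy
  set A₀ := Finset.univ.filter fun i => x i = 1 ∧ y i = 0 with hA₀
  set B₀ := Finset.univ.filter fun i => x i = 0 ∧ y i = 1 with hB₀
  have hcard := kWeight_add_card (x := x) (y := y) (A := A₀) (B := B₀) fun i => by
    simp only [hA₀, hB₀, Finset.mem_filter, Finset.mem_univ, true_and]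
    have : ∀ a b : Fin 2, (a : ℕ) + (if a = 0 ∧ b = 1 then 1 else 0)
      = b + if a = 1 ∧ b = 0 then 1 else 0 := by decide
    exact this _ _
  have hc : A₀.card = B₀.card := by omega
  have hdisj : Disjoint A₀ B₀ := Finset.disjoint_filter.2 fun i _ h1 h2 => by omega
  have hdist : hammingDist x y = 2 * A₀.card := by
    rw [two_mul]
    nth_rw 2 [hc]
    rw [← Finset.card_union_of_disjoint hdisj, hammingDist]
    congr 1
    ext i
    simp only [hA₀, hB₀, Finset.mem_filter, Finset.mem_univ, true_and, Finset.mem_union]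
    omega
  -- Correct equally many wrong ones and wrong zeros, which preserves the weight; the minimum covers
  -- the case where fewer than h of each remain.
  obtain ⟨A, hAs, hAc⟩ := Finset.exists_subset_card_eq (min_le_right h A₀.card)
  obtain ⟨B, hBs, hBc⟩ := Finset.exists_subset_card_eq (s := B₀) (n := min h A₀.card)
    (hc ▸ min_le_right h A₀.card)
  have hU : (A ∪ B).card = 2 * min h A₀.card := by
    rw [Finset.card_union_of_disjoint (Finset.disjoint_of_subset_left hAs
      (Finset.disjoint_of_subset_right hBs hdisj)), hAc, hBc, two_mul]
  have hUs : A ∪ B ⊆ A₀ ∪ B₀ := Finset.union_subset_union hAs hBs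
  have hne : ∀ i, i ∈ A₀ ∪ B₀ ↔ x i ≠ y i := fun i => by
    simp only [hA₀, hB₀, Finset.mem_filter, Finset.mem_univ, true_and, Finset.mem_union]
    omega
  refine ⟨flipOn x (A ∪ B), ?_, ?_, ?_⟩
  · change 2 * kWeight (flipOn x (A ∪ B)) = n
    rw [kWeight_flipOn (fun i hi => (Finset.mem_filter.1 (hAs hi)).2.1)
      (fun i hi => (Finset.mem_filter.1 (hBs hi)).2.1) (hAc.trans hBc.symm)]
    exact hx'
  · have : hammingDist x (flipOn x (A ∪ B)) = (A ∪ B).card := by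
      rw [hammingDist]
      congr 1
      ext i
      simp only [Finset.mem_filter, Finset.mem_univ, true_and]
      exact flipOn_apply_ne_iff x _ i
    rw [this, hU]
    exact Nat.mul_le_mul_left _ (min_le_left _ _)
  · have : hammingDist (flipOn x (A ∪ B)) y = ((A₀ ∪ B₀) \ (A ∪ B)).card := by
      rw [hammingDist]
      congr 1
      ext i
      rw [Finset.mem_filter, Finset.mem_sdiff, hne, ← flipOn_apply_ne_iff x (A ∪ B)]
      have h1 := hne i
      have h2 := @hUs i
      rw [h1, ← flipOn_apply_ne_iff x (A ∪ B)] at h2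
      simp only [Finset.mem_univ, true_and]
      omega
    rw [this, Finset.card_sdiff_of_subset hUs, hU, Finset.card_union_of_disjoint hdisj, ← hc]
    rw [hdist, add_mul, one_mul] at hxy
    rcases min_cases h A₀.card with ⟨h1, -⟩ | ⟨h1, -⟩ <;> rw [h1] <;> omega

end Cube

/-! ### Short paths and the diameter of the middle layer. -/

section MiddleLayer

/-- The unordered pair formed by two vertices of the middle layer. -/
def middlePair (n : ℕ) (x y : kMiddleLayer n) : Sym2 (KVertex n) := s(x.1, y.1)

lemma fiberLeTwo_middlePair (n : ℕ) [Fintype (kMiddleLayer n)] : FiberLeTwo (middlePair n) := by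
  intro e
  by_contra! hcard
  obtain ⟨z₁, hz₁, z₂, hz₂, z₃, hz₃, h12, h13, h23⟩ := Finset.two_lt_card.1 hcard
  simp only [Finset.mem_filter] at hz₁ hz₂ hz₃
  have hpair : ∀ z w : kMiddleLayer n × kMiddleLayer n, z ≠ w →
      middlePair n z.1 z.2 = middlePair n w.1 w.2 → w = z.swap := by
    intro z w hne h
    rw [middlePair, middlePair, Sym2.eq_iff] at h
    rcases h with h | h
    · exact absurd (Prod.ext (Subtype.ext h.1) (Subtype.ext h.2)) hne
    · exact Prod.ext (Subtype.ext h.2.symm) (Subtype.ext h.1.symm)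
  exact h23 ((hpair _ _ h12 (hz₁.2.trans hz₂.2.symm)).trans
    (hpair _ _ h13 (hz₁.2.trans hz₃.2.symm)).symm)

lemma openGraph_middlePair_le (n : ℕ) (ω : Sym2 (KVertex n) → Prop) :
    openGraph (middlePair n) ω ≤ (kGraphOf n ω).induce (kMiddleLayer n) := by
  intro x y h
  rw [openGraph, SimpleGraph.fromRel_adj] at h
  rw [SimpleGraph.comap_adj, kGraphOf, SimpleGraph.fromEdgeSet_adj]
  refine ⟨?_, fun hxy => h.1 (Subtype.ext hxy)⟩
  have hsw : middlePair n y x = middlePair n x y := Sym2.eq_swap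
  rw [hsw, or_self] at h
  exact h.2

lemma card_kMiddleLayer_le (n : ℕ) [Fintype (kMiddleLayer n)] :
    (Fintype.card (kMiddleLayer n) : ℝ) ≤ 2 ^ n := by
  have : Fintype.card (kMiddleLayer n) ≤ Fintype.card (KVertex n) :=
    Fintype.card_le_of_injective _ Subtype.val_injective
  have h2 : Fintype.card (KVertex n) = 2 ^ n := by simp
  exact_mod_cast h2 ▸ this

lemma mul_pow_le_probMatrix_pow {α β : unitInterval} {n l k : ℕ} (hl : l ≠ 0) {r τ : ℝ}
    (hr : 0 ≤ r) (h1 : r * (α : ℝ) ≤ β) (h2 : r * (β : ℝ) ≤ α) (hτ0 : 0 ≤ τ) (hτ1 : τ ≤ 1)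
    (hτr : τ ^ k ≤ r) [Fintype (kMiddleLayer n)] [DecidableEq (kMiddleLayer n)]
    {q : Sym2 (KVertex n) → unitInterval}
    (hq : ∀ e, ((2 * l : ℕ) : ℝ)⁻¹ * kEdgeProb α β α n e ≤ q e)
    {x y : kMiddleLayer n} (hxy : k * hammingDist x.1 y.1 ≤ n) :
    τ ^ n * (((2 * l : ℕ) : ℝ)⁻¹ ^ (2 * l) * (((α + β : ℝ) ^ n / (n + 1)) ^ (2 * l) / 2 ^ n))
      ≤ (probMatrix (middlePair n) q ^ (2 * l)) x y := by
  set W : Matrix (kMiddleLayer n) (kMiddleLayer n) ℝ :=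
    Matrix.of fun x y => pairProb α β x.1 y.1 with hW
  have hα := α.2.1
  have hβ := β.2.1
  have hW0 : ∀ x y, 0 ≤ W x y := fun x y => pairProb_nonneg hα hβ x.1 y.1
  have hdiag := pow_le_card_mul_matrix_pow_diag (W := W) (R := (α + β : ℝ) ^ n / (n + 1))
    (div_nonneg (pow_nonneg (add_nonneg hα hβ) _) (by positivity)) hW0
    (by ext x y; exact pairProb_comm _ _ _ _) (fun x => pow_le_rowSum_pairProb hα hβ x) l y
  have hdiag' : ((α + β : ℝ) ^ n / (n + 1)) ^ (2 * l) / 2 ^ n ≤ (W ^ (2 * l)) y y := by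
    rw [div_le_iff₀' (by positivity)]
    exact hdiag.trans (mul_le_mul_of_nonneg_right (card_kMiddleLayer_le n)
      (matrix_pow_nonneg hW0 _ _ _))
  have hτn : τ ^ n ≤ r ^ hammingDist x.1 y.1 := by
    calc τ ^ n ≤ τ ^ (k * hammingDist x.1 y.1) := pow_le_pow_of_le_one hτ0 hτ1 hxy
      _ = (τ ^ k) ^ hammingDist x.1 y.1 := pow_mul _ _ _
      _ ≤ _ := pow_le_pow_left₀ (pow_nonneg hτ0 _) hτr _
  have hmove : r ^ hammingDist x.1 y.1 * (W ^ (2 * l)) y y ≤ (W ^ (2 * l)) x y :=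
    pow_hammingDist_mul_matrix_pow_le hα hβ hr h1 h2 (by omega) x y y
  have hA := pow_mul_matrix_pow_le (A := probMatrix (middlePair n) q) (W := W)
    (c := ((2 * l : ℕ) : ℝ)⁻¹) (by positivity) hW0 (fun x y => by
      have := hq s(x.1, y.1)
      rwa [coe_kEdgeProb] at this) (2 * l) x y
  refine le_trans ?_ hA
  rw [mul_left_comm]
  refine mul_le_mul_of_nonneg_left ?_ (by positivity)
  refine le_trans ?_ hmove
  exact mul_le_mul hτn hdiag' (div_nonneg (pow_nonneg (div_nonneg
    (pow_nonneg (add_nonneg hα hβ) _) (by positivity)) _) (by positivity)) (pow_nonneg hr _)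

/-- Two vertices of the middle layer at small Hamming distance are likely to be joined by a
short path. -/
lemma real_lt_edist_middlePair_le {α β : unitInterval} {n l k : ℕ} (hn : n ≠ 0) (hl : l ≠ 0)
    (ha : 1 ≤ (α + β : ℝ)) {r τ : ℝ} (hr : 0 ≤ r) (h1 : r * (α : ℝ) ≤ β) (h2 : r * (β : ℝ) ≤ α)
    (hτ0 : 0 ≤ τ) (hτ1 : τ ≤ 1) (hτr : τ ^ k ≤ r)
    (hlarge : 8 * ((2 + 2 * (4 * n : ℝ)) ^ (2 * l) * (((α + β : ℝ) ^ (2 * l - 1) + 1) / 2) ^ n)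
      * (4 * n) * 4 ^ (2 * l) ≤ τ ^ n * (((2 * l : ℕ) : ℝ)⁻¹ ^ (2 * l) *
        (((α + β : ℝ) ^ n / (n + 1)) ^ (2 * l) / 2 ^ n)))
    {x y : kMiddleLayer n} (hxy : k * hammingDist x.1 y.1 ≤ n) :
    (bernoulliPi (kEdgeProb α β α n)).real
      {ω | ((2 * l : ℕ) : ℕ∞) < (openGraph (middlePair n) ω).edist x y}
      ≤ (2 * l : ℕ) * ((((2 * l : ℕ) + 1) * 2 ^ n + 1) * Real.exp (-(4 * n))) := by
  classical
  have : Fintype (kMiddleLayer n) := Fintype.ofFinite _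
  choose q hq1 hq2 hq3 using fun e =>
    exists_unitInterval_layer (kEdgeProb α β α n e) (L := 2 * l) (by omega)
  have hα := α.2.1
  have hβ := β.2.1
  have habs : |(α : ℝ) - β| ≤ 1 := abs_le.2 ⟨by linarith [β.2.2], by linarith [α.2.2]⟩
  set a : ℝ := α + β with ha_def
  have ha0 : 0 ≤ a := by linarith
  have hbase : ∀ m : ℕ, 1 ≤ (a ^ m + 1) / 2 := fun m => by
    linarith [one_le_pow₀ ha (n := m)]
  have key := real_lt_edist_le (fiberLeTwo_middlePair n) (kEdgeProb α β α n) q (L := 2 * l) hq1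
    (g := fun m => ((a ^ m + 1) / 2) ^ n) (s := 4 * n) (u := x) (v := y)
    (by positivity)
    (fun m x y => matrix_pow_le_pow hα hβ habs (fun x y => (q _).2.1)
      (fun x y => by
        rw [← coe_kEdgeProb]
        exact hq3 s(x.1, y.1)) m x y)
    (fun m => pow_pos (by linarith [hbase m]) _)
    (fun m m' h => pow_le_pow_left₀ (by linarith [hbase m])
      (by linarith [pow_le_pow_right₀ ha h]) _)
    (fun i j => by
      rw [← mul_pow]
      refine pow_le_pow_left₀ (mul_nonneg (by linarith [hbase i]) (by linarith [hbase j])) ?_ _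
      have hi := one_le_pow₀ ha (n := i)
      have hj := one_le_pow₀ ha (n := j)
      rw [pow_add]
      -- For x, y ≥ 1, (x + 1)(y + 1)/4 ≤ (xy + 1)/2 is equivalent to (x - 1)(y - 1) ≥ 0.
      nlinarith [mul_nonneg (sub_nonneg.2 hi) (sub_nonneg.2 hj)])
    (hlarge.trans (mul_pow_le_probMatrix_pow hl hr h1 h2 hτ0 hτ1 hτr hq2 hxy))
  refine key.trans (mul_le_mul_of_nonneg_left (mul_le_mul_of_nonneg_right ?_ (Real.exp_pos _).le)
    (by positivity))
  have := card_kMiddleLayer_le n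
  gcongr

lemma ediam_le_of_forall_hammingDist {n h t : ℕ} {L : ℕ} (G : SimpleGraph (kMiddleLayer n))
    (hG : ∀ x y : kMiddleLayer n, hammingDist x.1 y.1 ≤ 2 * h → G.edist x y ≤ L)
    (ht : n ≤ t * (2 * h)) : G.ediam ≤ (t * L : ℕ) := by
  have main : ∀ (t : ℕ) (x y : kMiddleLayer n), hammingDist x.1 y.1 ≤ t * (2 * h) →
      G.edist x y ≤ (t * L : ℕ) := by
    intro t
    induction t with
    | zero =>
      intro x y hxy
      rw [zero_mul, Nat.le_zero, hammingDist_eq_zero] at hxy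
      simp [Subtype.ext hxy]
    | succ t ih =>
      intro x y hxy
      obtain ⟨w, hw, h1, h2⟩ := exists_mem_kMiddleLayer_hammingDist_le x.2 y.2 hxy
      refine (SimpleGraph.edist_triangle (v := ⟨w, hw⟩)).trans ?_
      rw [Nat.succ_mul, Nat.cast_add, add_comm]
      exact add_le_add (ih ⟨w, hw⟩ y h2) (hG x ⟨w, hw⟩ h1)
  exact SimpleGraph.ediam_le_of_edist_le fun x y => main t x y
    ((hammingDist_le_card_fintype.trans (by simp)).trans ht)

lemma measurableSet_simpleGraph {V : Type*} [Finite V] (S : Set (SimpleGraph V)) :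
    MeasurableSet S :=
  SimpleGraph.measurableEmbedding_edgeSet.measurableSet_image.1 (Set.toFinite _).measurableSet

/-- Union bound with s = 4n: at most 4^n pairs, each failing with probability of order 2^n e^(-4n),
whence the base 8e^(-4). Otherwise 2k Hamming steps of at most L edges each suffice. -/
lemma one_sub_le_real_kroneckerGraph_ediam_lt {α β : unitInterval} {n l k : ℕ} (hk : k ≠ 0)
    (hn : 2 * k ≤ n) (hl : l ≠ 0)
    (ha : 1 ≤ (α + β : ℝ)) {r τ : ℝ} (hr : 0 ≤ r) (h1 : r * (α : ℝ) ≤ β) (h2 : r * (β : ℝ) ≤ α)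
    (hτ0 : 0 ≤ τ) (hτ1 : τ ≤ 1) (hτr : τ ^ k ≤ r)
    (hlarge : 8 * ((2 + 2 * (4 * n : ℝ)) ^ (2 * l) * (((α + β : ℝ) ^ (2 * l - 1) + 1) / 2) ^ n)
      * (4 * n) * 4 ^ (2 * l) ≤ τ ^ n * (((2 * l : ℕ) : ℝ)⁻¹ ^ (2 * l) *
        (((α + β : ℝ) ^ n / (n + 1)) ^ (2 * l) / 2 ^ n))) :
    1 - (2 * l : ℕ) * ((2 * l : ℕ) + 2) * (8 * Real.exp (-4)) ^ n
      ≤ (kroneckerGraph α β α n).real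
        {G | (G.induce (kMiddleLayer n)).ediam < ((2 * k * (2 * l) + 1 : ℕ) : ℕ∞)} := by
  classical
  have : Fintype (kMiddleLayer n) := Fintype.ofFinite _
  set L := 2 * l with hL
  set μ := bernoulliPi (kEdgeProb α β α n) with hμ
  set good := {ω : Sym2 (KVertex n) → Prop |
    ((kGraphOf n ω).induce (kMiddleLayer n)).ediam < ((2 * k * L + 1 : ℕ) : ℕ∞)} with hgood
  have hmap : (kroneckerGraph α β α n).real
      {G | (G.induce (kMiddleLayer n)).ediam < ((2 * k * L + 1 : ℕ) : ℕ∞)} = μ.real good := by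
    rw [kroneckerGraph, map_measureReal_apply (measurable_kGraphOf n)
      (measurableSet_simpleGraph _)]
    rfl
  rw [hmap]
  set δ : ℝ := L * (((L + 1) * 2 ^ n + 1) * Real.exp (-(4 * n))) with hδ
  have hδ0 : 0 ≤ δ := by positivity
  have hsub : goodᶜ ⊆ ⋃ z : kMiddleLayer n × kMiddleLayer n,
      {ω | k * hammingDist z.1.1 z.2.1 ≤ n ∧
        (L : ℕ∞) < (openGraph (middlePair n) ω).edist z.1 z.2} := by
    intro ω hω
    by_contra hcon
    simp only [Set.mem_iUnion, Set.mem_ofPred_eq, not_exists, not_and, not_lt] at hcon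
    refine hω ?_
    have hdiv := Nat.div_add_mod n (2 * k)
    have hmod := Nat.mod_lt n (show 0 < 2 * k by omega)
    have hpos : 1 ≤ n / (2 * k) := (Nat.one_le_div_iff (by omega)).2 hn
    -- Rounding down keeps steps of length 2h within n/k; as h ≥ 1, still n < 2k(h + 1) ≤ 2k · 2h,
    -- so 2k steps reach everywhere.
    set h := n / (2 * k) with hh
    have hkh : 2 * k ≤ 2 * k * h := Nat.le_mul_of_pos_right _ hpos
    have := ediam_le_of_forall_hammingDist (L := L) (h := h) (t := 2 * k)
      ((kGraphOf n ω).induce (kMiddleLayer n)) (fun x y hxy =>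
        (SimpleGraph.edist_anti (openGraph_middlePair_le n ω)).trans (hcon (x, y) (by
          calc k * hammingDist x.1 y.1 ≤ k * (2 * h) := Nat.mul_le_mul_left _ hxy
            _ = 2 * k * h := by ring
            _ ≤ n := by omega))) (by
        have : 2 * k * (2 * h) = 2 * (2 * k * h) := by ring
        omega)
    refine lt_of_le_of_lt this ?_
    exact_mod_cast Nat.lt_succ_self _
  have hcompl : μ.real goodᶜ ≤ Fintype.card (kMiddleLayer n × kMiddleLayer n) * δ := by
    refine (measureReal_mono hsub).trans ((measureReal_iUnion_fintype_le _).trans ?_)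
    refine (Finset.sum_le_card_nsmul _ _ δ fun z _ => ?_).trans (le_of_eq (by simp))
    by_cases hz : k * hammingDist z.1.1 z.2.1 ≤ n
    · simp only [hz, true_and]
      exact real_lt_edist_middlePair_le (by omega) hl ha hr h1 h2 hτ0 hτ1 hτr hlarge hz
    · simpa [hz] using hδ0
  rw [probReal_compl_eq_one_sub (Set.toFinite _).measurableSet] at hcompl
  have hbound : (Fintype.card (kMiddleLayer n × kMiddleLayer n) : ℝ) * δ
      ≤ L * (L + 2) * (8 * Real.exp (-4)) ^ n := by
    have hexp : Real.exp (-(4 * n : ℝ)) = Real.exp (-4) ^ n := by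
      rw [← Real.exp_nat_mul]
      congr 1
      ring
    have hc := card_kMiddleLayer_le n
    have h2n : (1 : ℝ) ≤ 2 ^ n := one_le_pow₀ (by norm_num)
    rw [Fintype.card_prod, Nat.cast_mul, hδ, hexp]
    calc _ ≤ (2 ^ n * 2 ^ n : ℝ) * (L * (((L + 1) * 2 ^ n + 2 ^ n) * Real.exp (-4) ^ n)) := by
          gcongr
      _ = L * (L + 2) * ((2 ^ n * 2 ^ n * 2 ^ n) * Real.exp (-4) ^ n) := by ring
      _ = _ := by
          rw [mul_pow, ← mul_pow, ← mul_pow]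
          norm_num
  linarith

end MiddleLayer

/-! ### Exponential growth against polynomial factors, and the choice of constants. -/

section Asymptotics

lemma eventually_mul_pow_mul_pow_le {b B : ℝ} (hb : 0 ≤ b) (hbB : b < B) (C : ℝ) (k : ℕ) :
    ∀ᶠ n : ℕ in Filter.atTop, C * (n : ℝ) ^ k * b ^ n ≤ B ^ n := by
  have hB : 0 < B := hb.trans_lt hbB
  have h := (tendsto_pow_const_mul_const_pow_of_abs_lt_one k (r := b / B) (by
    rw [abs_of_nonneg (by positivity), div_lt_one hB]
    exact hbB)).const_mul C
  rw [mul_zero] at h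
  filter_upwards [h.eventually_le_const zero_lt_one] with n hn
  rw [div_pow, ← mul_assoc, ← mul_div_assoc, div_le_one (by positivity)] at hn
  exact hn

/-- For fixed L only the exponential bases matter: (a^(L-1) + 1)/2 on the left, τ a^L/2 on the
right. -/
lemma eventually_chernoff_threshold_le {a τ : ℝ} (ha : 0 ≤ a) {L : ℕ} (hL : L ≠ 0)
    (h : a ^ (L - 1) + 1 < τ * a ^ L) :
    ∀ᶠ n : ℕ in Filter.atTop, 8 * ((2 + 2 * (4 * n : ℝ)) ^ L * ((a ^ (L - 1) + 1) / 2) ^ n)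
      * (4 * n) * 4 ^ L ≤ τ ^ n * ((L : ℝ)⁻¹ ^ L * ((a ^ n / (n + 1)) ^ L / 2 ^ n)) := by
  set b := (a ^ (L - 1) + 1) / 2 with hb
  have hb0 : 0 ≤ b := by positivity
  have hLpos : (0 : ℝ) < L := by exact_mod_cast Nat.pos_of_ne_zero hL
  filter_upwards [eventually_mul_pow_mul_pow_le hb0 (B := τ * a ^ L / 2) (by rw [hb]; linarith)
    (8 * 10 ^ L * 4 * 4 ^ L * L ^ L * 2 ^ L) (2 * L + 1), Filter.eventually_ge_atTop 1] with n hn hn1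
  have hn1' : (1 : ℝ) ≤ n := by exact_mod_cast hn1
  have e1 : τ ^ n * ((L : ℝ)⁻¹ ^ L * ((a ^ n / (n + 1)) ^ L / 2 ^ n))
      = (τ * a ^ L / 2) ^ n / (L ^ L * (n + 1) ^ L) := by
    rw [div_pow, div_pow, mul_pow, inv_pow, ← pow_mul, ← pow_mul, mul_comm n L]
    field_simp
  rw [e1, le_div_iff₀ (by positivity)]
  refine le_trans ?_ hn
  calc 8 * ((2 + 2 * (4 * n : ℝ)) ^ L * b ^ n) * (4 * n) * 4 ^ L * (L ^ L * (n + 1) ^ L)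
      ≤ 8 * ((10 * n : ℝ) ^ L * b ^ n) * (4 * n) * 4 ^ L * (L ^ L * (2 * n) ^ L) := by
        gcongr <;> linarith
    _ = _ := by rw [mul_pow, mul_pow]; ring

lemma eight_mul_exp_neg_four_lt_one : 8 * Real.exp (-4) < 1 := by
  have h : (8 : ℝ) < Real.exp 4 := by
    have h1 := Real.exp_one_gt_d9
    have h2 : Real.exp 4 = Real.exp 1 ^ 4 := by
      rw [← Real.exp_nat_mul]
      norm_num
    rw [h2]
    calc (8 : ℝ) < 2 ^ 4 := by norm_num
      _ ≤ _ := pow_le_pow_left₀ (by norm_num) (by linarith) 4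
  rw [Real.exp_neg, ← div_eq_mul_inv, div_lt_one (Real.exp_pos _)]
  exact h

end Asymptotics

theorem theorem3 (α β γ : unitInterval) (hαγ : α = γ) (hβγ : 1 < (β : ℝ) + (γ : ℝ)) :
    ∃ c : ℕ, Filter.Tendsto
      (fun n : ℕ => (kroneckerGraph α β γ n).real
        {G | (G.induce (kMiddleLayer n)).ediam < (c : ℕ∞)})
      (Filter.atTop ⊓ Filter.principal {n : ℕ | Even n}) (nhds 1) := by
  subst hαγ
  have hα : (0 : ℝ) < α := by linarith [β.2.2]
  have hβ : (0 : ℝ) < β := by linarith [α.2.2]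
  set a : ℝ := α + β with ha_def
  have ha : 1 < a := by rw [ha_def]; linarith
  have ha0 : 0 < a := by linarith
  -- τ > 1/a keeps growth per step after the Hamming loss; τ < 1 allows a `k` with τ^k ≤ r.
  obtain ⟨τ, hτa, hτ1⟩ := exists_between (inv_lt_one_of_one_lt₀ ha)
  have hτ0 : 0 < τ := (inv_pos.2 ha0).trans hτa
  have hτa' : 1 < τ * a := by rwa [inv_lt_iff_one_lt_mul₀ ha0] at hτa
  set r : ℝ := min (β / α) (α / β) with hr_def
  have hr : 0 < r := lt_min (by positivity) (by positivity)
  have h1 : r * (α : ℝ) ≤ β := (le_div_iff₀ hα).1 (min_le_left _ _)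
  have h2 : r * (β : ℝ) ≤ α := (le_div_iff₀ hβ).1 (min_le_right _ _)
  obtain ⟨k, hk⟩ := exists_pow_lt_of_lt_one hr hτ1
  have hk' : τ ^ (k + 1) ≤ r := (pow_le_pow_of_le_one hτ0.le hτ1.le (Nat.le_succ k)).trans hk.le
  -- Then a^N (τ a - 1) > 1, which absorbs the additive 1 in `hbase`.
  obtain ⟨N, hN⟩ := pow_unbounded_of_one_lt (1 / (τ * a - 1)) ha
  set l := N + 1 with hl
  have hbase : a ^ (2 * l - 1) + 1 < τ * a ^ (2 * l) := by
    have h3 : a ^ N ≤ a ^ (2 * l - 1) := pow_le_pow_right₀ ha.le (by omega)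
    have h4 : 1 < a ^ (2 * l - 1) * (τ * a - 1) :=
      (div_lt_iff₀ (by linarith)).1 (hN.trans_le h3)
    have h5 : a ^ (2 * l) = a ^ (2 * l - 1) * a := by
      rw [← pow_succ]
      congr 1
    rw [h5]
    linarith
  -- The limit is proved along all n: for odd n the layer is empty and the bounds on its vertices
  -- are vacuous.
  refine ⟨2 * (k + 1) * (2 * l) + 1, Filter.Tendsto.mono_left ?_ inf_le_left⟩
  have hlim : Filter.Tendsto (fun n : ℕ => 1 - ((2 * l : ℕ) : ℝ) * ((2 * l : ℕ) + 2) *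
      (8 * Real.exp (-4)) ^ n) Filter.atTop (nhds 1) := by
    have := ((tendsto_pow_atTop_nhds_zero_of_lt_one (by positivity)
      eight_mul_exp_neg_four_lt_one).const_mul
        (((2 * l : ℕ) : ℝ) * ((2 * l : ℕ) + 2))).const_sub 1
    simpa only [mul_zero, sub_zero] using this
  refine tendsto_of_tendsto_of_tendsto_of_le_of_le' hlim tendsto_const_nhds ?_
    (Filter.Eventually.of_forall fun n => measureReal_le_one)
  filter_upwards [eventually_chernoff_threshold_le ha0.le (L := 2 * l) (by omega) hbase,
    Filter.eventually_ge_atTop (2 * (k + 1))] with n hn hn2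
  exact one_sub_le_real_kroneckerGraph_ediam_lt (Nat.succ_ne_zero k) hn2 (Nat.succ_ne_zero N)
    ha.le hr.le h1 h2 hτ0.le hτ1.le hk' hn
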